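/- Let $p$ be an odd prime and let $n$ be a positive integer. Let $\left(\frac{\cdot}{q}\right)$ denote the Legendre symbol modulo an odd prime $q$ (with value $0$ at multiples of $q$), and let $C_k=\frac{1}{k+1}\binom{2k}{k}$ be the $k$-th Catalan number. For $x,y\in\mathbb{Q}$, write $x\equiv y \pmod{p^2}$ if $x-y\in p^2\mathbb{Z}_p$, where $\mathbb{Z}_p$ is the ring of $p$-adic integers. Then $$\frac1n\left(\sum_{k=0}^{pn-1}\binom{2k}{k}-\left(\frac p3\right)\sum_{r=0}^{n-1}\binom{2r}{r}\right)\equiv 0\pmod{p^2},$$ $$\frac1n\left(\sum_{k=0}^{pn-1}\frac{\binom{2k}{k}}{2^k}-\left(\frac{-1}p\right)\sum_{r=0}^{n-1}\frac{\binom{2r}{r}}{2^r}\right)\equiv 0\pmod{p^2},$$ and $$\frac1n\left(\sum_{k=0}^{pn-1}C_k-\left(\frac p3\right)\sum_{r=0}^{n-1}C_r+\frac{1-\left(\frac p3\right)}{2}\left(\binom{2n}{n}-1\right)\right)\equiv 0\pmod{p^2}.$$ If moreover $p>3$, then also $$\frac1n\left(\sum_{k=0}^{pn-1}\frac{\binom{2k}{k}}{3^k}-\left(\frac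 p3\right)\sum_{r=0}^{n-1}\frac{\binom{2r}{r}}{3^r}\right)\equiv 0\pmod{p^2}.$$ -/

import Mathlib

open scoped BigOperators

/-- Congruence of rational numbers modulo `M` in the ring `ℤ_[p]` of `p`-adic integers:
`x ≡ y (mod M)` means that `x - y` belongs to `M ℤ_[p]`, i.e. `x - y = M * c` in `ℚ_[p]` for some
`p`-adic integer `c`. -/
def PadicModEq (p : ℕ) [Fact p.Prime] (M : ℕ) (x y : ℚ) : Prop :=
  ∃ c : ℤ_[p], ((x - y : ℚ) : ℚ_[p]) = (M : ℚ_[p]) * (c : ℚ_[p])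

/-! Let `u` satisfy `u (k+1) + u (k-1) = (m-2) * u k`, with `u 0 = 0` and `u 1 = 1`. Then `∑_{k<n}
C(2k,k) m^(n-1-k) = ∑_{j<n} C(2n,j) u (n-j)`, so each sum over `pn` terms is a linear functional of
`(1+X)^(2pn)`. Write `(1+X)^p = (1+X^p) + pG`. If `p^v ∣ n`, only the terms of degree at most one in
`pG` survive modulo `p^(v+2)`, and division by `n` then leaves `p^2`. When `u (pM) = χ u M` and a
half-shifted analogue holds with a sign `σ`, the constant term gives `χ F` and the linear one `2n χ
(σ m^h - 1) F`, where `p = 2h+1` and `F` is the sum for `n`. Together they are `χ (σ m^h)^(2n) F = χ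
m^((p-1)n) F`, the power of `m` needed to rescale. For `m = 1, 2, 3` the sequence `u` is periodic,
so its hypotheses are finite checks. The Catalan sum reduces to `m = 1` and a congruence for
`C(2pn,pn)`. -/

/-! ### First-order expansion of `(1+X)^(pN)` and weighted binomial sums -/

open Polynomial in
/-- The linear functional on `ℤ[X]` sending `X ^ i` to `w i`. -/
noncomputable def Polynomial.momentFunctional (w : ℕ → ℤ) : ℤ[X] →ₗ[ℤ] ℤ :=
  (Polynomial.basisMonomials ℤ).constr ℤ w

theorem Polynomial.momentFunctional_X_pow (w : ℕ → ℤ) (i : ℕ) :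
    Polynomial.momentFunctional w (Polynomial.X ^ i) = w i := by
  have h := (Polynomial.basisMonomials ℤ).constr_basis ℤ w i
  rw [Polynomial.coe_basisMonomials] at h
  rw [Polynomial.X_pow_eq_monomial]
  exact h

theorem Polynomial.momentFunctional_C_mul (w : ℕ → ℤ) (c : ℤ) (P : Polynomial ℤ) :
    Polynomial.momentFunctional w (Polynomial.C c * P)
      = c * Polynomial.momentFunctional w P := by
  rw [← Polynomial.smul_eq_C_mul, map_smul, smul_eq_mul]

/-- From `k C(N,k) = N C(N-1,k-1)`, the binomial loses at most the `p`-part `p^w` of `k`. For `p ≥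
3` one has `k ≥ w + 2`; for `p = k = 2` this fails. -/
theorem pow_add_two_dvd_choose_mul_pow {p : ℕ} (hp : p.Prime) (hodd : Odd p) {v N : ℕ}
    (hN : p ^ v ∣ N) {k : ℕ} (hk : 2 ≤ k) : p ^ (v + 2) ∣ N.choose k * p ^ k := by
  obtain ⟨j, rfl⟩ : ∃ j, k = j + 1 := ⟨k - 1, by omega⟩
  rcases N with _ | M
  · simp
  obtain ⟨w, t, ht, hwt⟩ := Nat.exists_eq_pow_mul_and_not_dvd (n := j + 1) (by omega) p hp.ne_one
  have hp3 : 3 ≤ p := by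
    have := hp.two_le
    rcases hodd with ⟨r, rfl⟩
    omega
  have hw : w + 2 ≤ j + 1 := by
    rcases Nat.lt_or_ge w 1 with h | h
    · omega
    · have h1 : p ^ w ≤ j + 1 := Nat.le_of_dvd (by omega) ⟨t, hwt⟩
      have h2 : 3 ^ w ≤ p ^ w := Nat.pow_le_pow_left hp3 w
      have h3 : ∀ d : ℕ, 1 ≤ d → d + 2 ≤ 3 ^ d := by
        intro d hd
        induction d, hd using Nat.le_induction with
        | base => norm_num
        | succ d _ ih => rw [pow_succ]; omega
      have := h3 w h
      omega
  have h1 : p ^ v ∣ p ^ w * (M + 1).choose (j + 1) := by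
    have h2 : p ^ v ∣ t * (p ^ w * (M + 1).choose (j + 1)) := by
      have h3 := Nat.add_one_mul_choose_eq M j
      have h4 : t * (p ^ w * (M + 1).choose (j + 1)) = (M + 1) * M.choose j := by
        rw [h3, hwt]; ring
      rw [h4]
      exact hN.mul_right _
    exact (Nat.Coprime.pow_left v ((Nat.Prime.coprime_iff_not_dvd hp).2 ht)).dvd_of_dvd_mul_left h2
  calc p ^ (v + 2) ∣ p ^ w * (M + 1).choose (j + 1) * p ^ 2 := by
        rw [pow_add]; exact mul_dvd_mul_right h1 _
    _ = (M + 1).choose (j + 1) * p ^ (w + 2) := by ring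
    _ ∣ _ := mul_dvd_mul_left _ (pow_dvd_pow _ hw)

/-- First-order Taylor expansion of `(a + p g) ^ N` modulo `p ^ (v + 2)`, where `p ^ v ∣ N`. -/
theorem pow_add_two_dvd_add_pow_sub {R : Type*} [CommRing R] {p : ℕ} (hp : p.Prime)
    (hodd : Odd p) {v M : ℕ} (hN : p ^ v ∣ M + 1) (a g : R) :
    (p : R) ^ (v + 2) ∣
      (a + p * g) ^ (M + 1) - a ^ (M + 1) - ((M + 1 : ℕ) : R) * ((p * g) * a ^ M) := by
  rw [add_comm a, add_pow, Finset.sum_range_succ', Finset.sum_range_succ']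
  have h : ((p : R) * g) ^ (0 + 1) * a ^ (M + 1 - (0 + 1)) * ((M + 1).choose (0 + 1) : R)
      = ((M + 1 : ℕ) : R) * ((p * g) * a ^ M) := by
    simp; ring
  rw [h]
  simp only [pow_zero, one_mul, Nat.sub_zero, Nat.choose_zero_right, Nat.cast_one, mul_one]
  have h2 : ∀ x y z : R, x + y + z - z - y = x := fun x y z => by ring
  rw [h2]
  refine Finset.dvd_sum fun k _ => ?_
  have h3 := pow_add_two_dvd_choose_mul_pow hp hodd hN (k := k + 1 + 1) (by omega)
  have h4 := Nat.cast_dvd_cast (α := R) h3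
  push_cast at h4
  refine (h4.mul_right (g ^ (k + 1 + 1) * a ^ (M + 1 - (k + 1 + 1)))).trans (dvd_of_eq ?_)
  rw [mul_pow]; ring

open Polynomial in
theorem one_add_X_pow_prime {p : ℕ} (hp : p.Prime) :
    ∃ G : ℤ[X], (1 + X : ℤ[X]) ^ p = (1 + X ^ p) + (p : ℤ[X]) * G ∧
      (p : ℤ[X]) * G = ∑ i ∈ Finset.Ico 1 p, C ((p.choose i : ℕ) : ℤ) * X ^ i := by
  refine ⟨∑ i ∈ Finset.Ico 1 p, C ((p.choose i / p : ℕ) : ℤ) * X ^ i, ?_⟩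
  have h : (p : ℤ[X]) * ∑ i ∈ Finset.Ico 1 p, C ((p.choose i / p : ℕ) : ℤ) * X ^ i
      = ∑ i ∈ Finset.Ico 1 p, C ((p.choose i : ℕ) : ℤ) * X ^ i := by
    rw [Finset.mul_sum]
    refine Finset.sum_congr rfl fun i hi => ?_
    rw [Finset.mem_Ico] at hi
    have h1 : p * (p.choose i / p) = p.choose i :=
      Nat.mul_div_cancel' (hp.dvd_choose_self (by omega) hi.2)
    conv_rhs => rw [← h1]
    push_cast
    simp [mul_assoc]
  refine ⟨?_, h⟩
  rw [h, add_comm (1 : ℤ[X]) X, add_pow, Finset.sum_range_succ, Finset.range_eq_Ico,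
    Finset.sum_eq_sum_Ico_succ_bot hp.pos]
  simp only [one_pow, mul_one, pow_zero, Nat.choose_zero_right, Nat.choose_self, Nat.cast_one,
    zero_add]
  have : ∀ i, (X : ℤ[X]) ^ i * (p.choose i : ℤ[X]) = C ((p.choose i : ℕ) : ℤ) * X ^ i := by
    intro i; simp [mul_comm]
  simp only [this]
  ring

open Polynomial in
/-- Weighted binomial sums of order `p N`, modulo `p ^ (v + 2)` where `p ^ v ∣ N`. -/
theorem pow_dvd_sum_choose_mul_sub {p : ℕ} (hp : p.Prime) (hodd : Odd p) {v M : ℕ}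
    (hN : p ^ v ∣ M + 1) (w : ℕ → ℤ) :
    (p : ℤ) ^ (v + 2) ∣
      ∑ k ∈ Finset.range (p * (M + 1) + 1), ((p * (M + 1)).choose k : ℤ) * w k
      - ∑ s ∈ Finset.range (M + 1 + 1), ((M + 1).choose s : ℤ) * w (p * s)
      - ((M + 1 : ℕ) : ℤ) * ∑ s ∈ Finset.range (M + 1), (M.choose s : ℤ) *
          ∑ i ∈ Finset.Ico 1 p, (p.choose i : ℤ) * w (p * s + i) := by
  obtain ⟨G, hG, hG'⟩ := one_add_X_pow_prime hp
  obtain ⟨Q, hQ⟩ := pow_add_two_dvd_add_pow_sub hp hodd hN (1 + X ^ p : ℤ[X]) G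
  rw [← hG, ← pow_mul, hG'] at hQ
  have e1 : ∀ (q K : ℕ), (1 + X ^ q : ℤ[X]) ^ K
      = ∑ s ∈ Finset.range (K + 1), C ((K.choose s : ℕ) : ℤ) * X ^ (q * s) := by
    intro q K
    rw [add_comm, add_pow]
    refine Finset.sum_congr rfl fun s _ => ?_
    simp [pow_mul, mul_comm]
  have e2 := e1 1 (p * (M + 1))
  simp only [pow_one, one_mul] at e2
  have e3 : (∑ i ∈ Finset.Ico 1 p, C ((p.choose i : ℕ) : ℤ) * X ^ i) * (1 + X ^ p : ℤ[X]) ^ M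
      = ∑ s ∈ Finset.range (M + 1), C ((M.choose s : ℕ) : ℤ) *
          ∑ i ∈ Finset.Ico 1 p, C ((p.choose i : ℕ) : ℤ) * X ^ (p * s + i) := by
    rw [e1, Finset.mul_sum]
    refine Finset.sum_congr rfl fun s _ => ?_
    rw [Finset.sum_mul, Finset.mul_sum]
    refine Finset.sum_congr rfl fun i _ => ?_
    rw [pow_add]; ring
  rw [e2, e1, e3] at hQ
  have e4 : ((M + 1 : ℕ) : ℤ[X]) = C ((M + 1 : ℕ) : ℤ) := by simp
  have e5 : (p : ℤ[X]) ^ (v + 2) = C ((p : ℤ) ^ (v + 2)) := by simp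
  rw [e4, e5] at hQ
  have := congrArg (momentFunctional w) hQ
  simp only [map_sub, map_sum, momentFunctional_C_mul, momentFunctional_X_pow] at this
  exact ⟨_, this⟩

/-! ### Lucas sequences and binomial sums -/

theorem sum_choose_succ_mul (K M : ℕ) (f : ℕ → ℤ) :
    ∑ j ∈ Finset.range (M + 1), ((K + 1).choose j : ℤ) * f j
      = ∑ j ∈ Finset.range (M + 1), (K.choose j : ℤ) * (f j + f (j + 1))
        - (K.choose M : ℤ) * f (M + 1) := by
  induction M with
  | zero => simp
  | succ M ih =>
    rw [Finset.sum_range_succ, ih, Finset.sum_range_succ _ (M + 1), Nat.choose_succ_succ]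
    push_cast
    ring

theorem sum_choose_succ_mul_full (K : ℕ) (f : ℕ → ℤ) :
    ∑ j ∈ Finset.range (K + 2), ((K + 1).choose j : ℤ) * f j
      = ∑ j ∈ Finset.range (K + 1), (K.choose j : ℤ) * (f j + f (j + 1)) := by
  rw [sum_choose_succ_mul, Finset.sum_range_succ _ (K + 1), Nat.choose_succ_self]
  simp

/-- The recurrence of the Lucas sequence `u_k(m - 2, 1)`, extended to integer indices. -/
structure IsLucasSeq (m : ℤ) (u : ℤ → ℤ) : Prop where
  zero : u 0 = 0
  one : u 1 = 1
  recurrence : ∀ k, u (k + 1) + u (k - 1) = (m - 2) * u k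

namespace IsLucasSeq

variable {m : ℤ} {u : ℤ → ℤ}

theorem three_term (hu : IsLucasSeq m u) (a : ℤ) :
    u a + u (a - 1) + (u (a - 1) + u (a - 2)) = m * u (a - 1) := by
  have := hu.recurrence (a - 1)
  rw [sub_add_cancel, sub_sub, one_add_one_eq_two] at this
  linarith

theorem neg_one (hu : IsLucasSeq m u) : u (-1) = -1 := by
  have := hu.recurrence 0
  simp [hu.zero, hu.one] at this
  linarith

/-- Two uses of Pascal's rule pass from row `2N+2` to row `2N`, and `u a + 2 u (a-1) + u (a-2) = m u
(a-1)` extracts a factor `m`. Since `u 0 = 0` and `u (-1) = -1`, the cut-off contributes exactly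
`C(2N,N)`. -/
theorem sum_centralBinom_mul_pow (hu : IsLucasSeq m u) (N : ℕ) :
    ∑ k ∈ Finset.range (N + 1), ((2 * k).choose k : ℤ) * m ^ (N - k)
      = ∑ j ∈ Finset.range (N + 1), ((2 * (N + 1)).choose j : ℤ) * u ((N + 1 : ℕ) - j) := by
  have step : ∀ N : ℕ,
      ∑ j ∈ Finset.range (N + 1), ((2 * (N + 1)).choose j : ℤ) * u ((N + 1 : ℕ) - j)
      = m * ∑ j ∈ Finset.range N, ((2 * N).choose j : ℤ) * u (N - j)
        + ((2 * N).choose N : ℤ) := by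
    intro N
    rw [show 2 * (N + 1) = 2 * N + 1 + 1 by ring,
      sum_choose_succ_mul _ _ (fun j => u ((N + 1 : ℕ) - j)),
      sum_choose_succ_mul _ _ (fun j => u ((N + 1 : ℕ) - j) + u ((N + 1 : ℕ) - (j + 1 : ℕ)))]
    have h0 : u ((N + 1 : ℕ) - (N + 1 : ℕ)) = 0 := by rw [sub_self, hu.zero]
    have h1 : u ((N + 1 : ℕ) - (N + 1 + 1 : ℕ)) = -1 := by
      rw [← hu.neg_one]; congr 1; push_cast; ring
    rw [h0, h1]
    have h2 : ∀ j : ℕ, u ((N + 1 : ℕ) - j) + u ((N + 1 : ℕ) - (j + 1 : ℕ))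
        + (u ((N + 1 : ℕ) - (j + 1 : ℕ)) + u ((N + 1 : ℕ) - (j + 1 + 1 : ℕ)))
        = m * u (N - j) := by
      intro j
      have := hu.three_term ((N + 1 : ℕ) - j)
      have a1 : ((N + 1 : ℕ) : ℤ) - (j + 1 : ℕ) = N - j := by push_cast; ring
      have a2 : ((N + 1 : ℕ) : ℤ) - (j + 1 + 1 : ℕ) = N - j - 1 := by push_cast; ring
      have a3 : ((N + 1 : ℕ) : ℤ) - j - 1 = N - j := by push_cast; ring
      have a4 : ((N + 1 : ℕ) : ℤ) - j - 2 = N - j - 1 := by push_cast; ring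
      rw [a1, a2]
      rw [a3, a4] at this
      exact this
    simp only [h2]
    rw [Finset.sum_range_succ, sub_self, hu.zero, Finset.mul_sum]
    simp only [mul_left_comm _ m]
    ring
  induction N with
  | zero => simp [hu.one]
  | succ N ih =>
    rw [step (N + 1), ← ih, Finset.sum_range_succ, Finset.mul_sum, Nat.sub_self, pow_zero, mul_one]
    congr 1
    refine Finset.sum_congr rfl fun k hk => ?_
    rw [Finset.mem_range] at hk
    rw [show N + 1 - k = N - k + 1 by omega, pow_succ]
    ring

/-- With `S` the backward shift, `(1+S)^2 = m S` on `u`, hence `(1+S)^(2h+1) = m^h S^h (1+S)`. -/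
theorem sum_choose_odd (hu : IsLucasSeq m u) (h : ℕ) (a : ℤ) :
    ∑ i ∈ Finset.range (2 * h + 2), ((2 * h + 1).choose i : ℤ) * u (a - i)
      = m ^ h * (u (a - h) + u (a - h - 1)) := by
  induction h generalizing a with
  | zero => simp [Finset.sum_range_succ]
  | succ h ih =>
    have e : ∀ j : ℕ, u (a - j) + u (a - (j + 1 : ℕ))
        + (u (a - (j + 1 : ℕ)) + u (a - (j + 1 + 1 : ℕ))) = m * u (a - 1 - j) := by
      intro j
      have := hu.three_term (a - j)
      have a1 : a - (j + 1 : ℕ) = a - 1 - j := by push_cast; ring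
      have a2 : a - (j + 1 + 1 : ℕ) = a - 1 - j - 1 := by push_cast; ring
      have a3 : a - j - 1 = a - 1 - j := by ring
      have a4 : a - j - 2 = a - 1 - j - 1 := by ring
      rw [a1, a2]
      rw [a3, a4] at this
      exact this
    rw [show 2 * (h + 1) + 2 = 2 * h + 2 + 2 by ring, show 2 * (h + 1) + 1 = 2 * h + 2 + 1 by ring,
      sum_choose_succ_mul_full _ (fun j => u (a - j)),
      sum_choose_succ_mul_full _ (fun j => u (a - j) + u (a - (j + 1 : ℕ)))]
    simp only [e, mul_left_comm _ m]
    rw [← Finset.mul_sum, ih (a - 1), pow_succ]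
    have a1 : a - 1 - h = a - (h + 1 : ℕ) := by push_cast; ring
    rw [a1]
    ring

theorem sum_choose_prime (hu : IsLucasSeq m u) {p : ℕ} {h : ℕ} (hh : p = 2 * h + 1) (a : ℤ) :
    ∑ i ∈ Finset.Ico 1 p, (p.choose i : ℤ) * u (a - i)
      = m ^ h * (u (a - h) + u (a - h - 1)) - u a - u (a - p) := by
  have := hu.sum_choose_odd h a
  rw [show 2 * h + 2 = p + 1 by omega, ← hh, Finset.sum_range_succ, Finset.range_eq_Ico,
    Finset.sum_eq_sum_Ico_succ_bot (by omega)] at this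
  simp at this
  linarith

end IsLucasSeq

/-! ### The main congruence over the integers -/

theorem sum_range_mul_ite_lt {A B : ℕ} (hAB : A ≤ B) (g f : ℕ → ℤ) :
    ∑ k ∈ Finset.range B, g k * (if k < A then f k else 0)
      = ∑ k ∈ Finset.range A, g k * f k := by
  rw [← Finset.sum_subset (Finset.range_mono hAB)]
  · refine Finset.sum_congr rfl fun k hk => ?_
    rw [if_pos (Finset.mem_range.1 hk)]
  · intro k _ hk
    rw [if_neg (by simpa using hk), mul_zero]

namespace IsLucasSeq

variable {m : ℤ} {u : ℤ → ℤ}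

/-- If `u` is compatible with multiplication of indices by `p`, then
`∑_{k < pn} C(2k,k) m^(pn-1-k) ≡ χ m^((p-1)n) ∑_{k < n} C(2k,k) m^(n-1-k)` modulo
`p ^ (v + 2)`, where `n = N + 1` and `p ^ v ∣ n`. -/
theorem pow_dvd_sum_centralBinom_sub (hu : IsLucasSeq m u) {p h : ℕ} (hp : p.Prime)
    (hh : p = 2 * h + 1) {χ σ : ℤ} (hσ : σ ^ 2 = 1) (hdvd : (p : ℤ) ∣ σ * m ^ h - 1)
    (h1 : ∀ M : ℤ, u (p * M) = χ * u M)
    (h2 : ∀ M : ℤ, u (p * M - h) + u (p * M - h - 1) = σ * χ * (u M + u (M - 1)))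
    {v N : ℕ} (hN : p ^ v ∣ N + 1) :
    (p : ℤ) ^ (v + 2) ∣
      ∑ k ∈ Finset.range (p * (N + 1)), ((2 * k).choose k : ℤ) * m ^ (p * (N + 1) - 1 - k)
      - χ * m ^ ((p - 1) * (N + 1)) *
        ∑ k ∈ Finset.range (N + 1), ((2 * k).choose k : ℤ) * m ^ (N - k) := by
  have hodd : Odd p := ⟨h, hh⟩
  have hp0 := hp.pos
  obtain ⟨P, hP⟩ : ∃ P, p * (N + 1) = P + 1 :=
    ⟨_, (Nat.succ_pred_eq_of_pos (Nat.mul_pos hp0 (Nat.succ_pos N))).symm⟩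
  have hF := hu.sum_centralBinom_mul_pow N
  have hFp := hu.sum_centralBinom_mul_pow P
  rw [hP, Nat.add_sub_cancel, hFp, hF]
  set F := ∑ j ∈ Finset.range (N + 1), ((2 * (N + 1)).choose j : ℤ) * u ((N + 1 : ℕ) - j) with hFdef
  have hN2 : p ^ v ∣ (2 * N + 1) + 1 := by
    rw [show 2 * N + 1 + 1 = 2 * (N + 1) by ring]; exact hN.mul_left 2
  -- The weights keep the lower half of row `2pn`. The cut-off is a multiple of `p`, so each block
  -- `ps + i` with `0 < i < p` is kept or dropped whole.
  have key := pow_dvd_sum_choose_mul_sub hp hodd hN2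
    (fun k => if k < p * (N + 1) then u ((p * (N + 1) : ℕ) - k) else 0)
  have hle : p * (N + 1) ≤ p * (2 * N + 1 + 1) + 1 := by
    have : p * (N + 1) ≤ p * (2 * N + 1 + 1) := Nat.mul_le_mul_left p (by omega)
    omega
  have e1 : ∑ k ∈ Finset.range (p * (2 * N + 1 + 1) + 1), ((p * (2 * N + 1 + 1)).choose k : ℤ) *
        (if k < p * (N + 1) then u ((p * (N + 1) : ℕ) - k) else 0)
      = ∑ j ∈ Finset.range (P + 1), ((2 * (P + 1)).choose j : ℤ) * u ((P + 1 : ℕ) - j) := by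
    rw [sum_range_mul_ite_lt hle _ (fun k : ℕ => u ((p * (N + 1) : ℕ) - k)),
      show p * (2 * N + 1 + 1) = 2 * (p * (N + 1)) by ring, hP]
  have e2 : ∑ s ∈ Finset.range (2 * N + 1 + 1 + 1), ((2 * N + 1 + 1).choose s : ℤ) *
        (if p * s < p * (N + 1) then u ((p * (N + 1) : ℕ) - (p * s : ℕ)) else 0)
      = χ * F := by
    simp only [Nat.mul_lt_mul_left hp0]
    rw [sum_range_mul_ite_lt (by omega) _ (fun s : ℕ => u ((p * (N + 1) : ℕ) - (p * s : ℕ))),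
      hFdef, Finset.mul_sum]
    refine Finset.sum_congr rfl fun s _ => ?_
    rw [show ((p * (N + 1) : ℕ) : ℤ) - (p * s : ℕ) = p * ((N + 1 : ℕ) - s) by push_cast; ring, h1,
      show 2 * N + 1 + 1 = 2 * (N + 1) by ring]
    ring
  have e3 : ∑ s ∈ Finset.range (2 * N + 1 + 1), ((2 * N + 1).choose s : ℤ) *
        ∑ i ∈ Finset.Ico 1 p, (p.choose i : ℤ) *
          (if p * s + i < p * (N + 1) then u ((p * (N + 1) : ℕ) - (p * s + i : ℕ)) else 0)
      = χ * (σ * m ^ h - 1) * F := by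
    have inner : ∀ s : ℕ, ∑ i ∈ Finset.Ico 1 p, (p.choose i : ℤ) *
          (if p * s + i < p * (N + 1) then u ((p * (N + 1) : ℕ) - (p * s + i : ℕ)) else 0)
        = if s < N + 1 then χ * (σ * m ^ h - 1) *
            (u ((N + 1 : ℕ) - s) + u ((N + 1 : ℕ) - (s + 1 : ℕ))) else 0 := by
      intro s
      split_ifs with hs
      · have hs' : p * (s + 1) ≤ p * (N + 1) := Nat.mul_le_mul_left p hs
        have := hu.sum_choose_prime hh (p * ((N + 1 : ℕ) - s))
        rw [h2, show (p : ℤ) * ((N + 1 : ℕ) - s) - p = p * ((N + 1 : ℕ) - s - 1) by ring, h1, h1]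
          at this
        have e : ((N + 1 : ℕ) : ℤ) - (s + 1 : ℕ) = (N + 1 : ℕ) - s - 1 := by push_cast; ring
        rw [e]
        refine Eq.trans (Finset.sum_congr rfl fun i hi => ?_) (this.trans (by ring))
        rw [Finset.mem_Ico] at hi
        rw [if_pos (by rw [mul_add, mul_one] at hs'; omega)]
        congr 2
        push_cast; ring
      · refine Finset.sum_eq_zero fun i _ => ?_
        have hs' : p * (N + 1) ≤ p * s := Nat.mul_le_mul_left p (by omega)
        rw [if_neg (by omega), mul_zero]
    simp only [inner]
    rw [sum_range_mul_ite_lt (by omega) _ (fun s : ℕ => χ * (σ * m ^ h - 1) *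
      (u ((N + 1 : ℕ) - s) + u ((N + 1 : ℕ) - (s + 1 : ℕ)))), hFdef,
      -- Pascal's rule reassembles row `2n - 1` into `F`; its boundary term vanishes because `u 0 =
      -- 0`.
      show 2 * (N + 1) = 2 * N + 1 + 1 by ring,
      sum_choose_succ_mul _ _ (fun s => u ((N + 1 : ℕ) - s)), sub_self, hu.zero, mul_zero,
      sub_zero, Finset.mul_sum]
    exact Finset.sum_congr rfl fun s _ => by ring
  rw [e1, e2, e3] at key
  obtain ⟨g, hg⟩ := hdvd
  -- The same expansion, applied to `(1 + pg)^(2n)` with `1 + pg = σ m^h`, absorbs the linear term;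
  -- the even exponent removes `σ`.
  have taylor := pow_add_two_dvd_add_pow_sub hp hodd hN2 (1 : ℤ) g
  rw [← hg, add_sub_cancel, show 2 * N + 1 + 1 = 2 * (N + 1) by ring, mul_pow, pow_mul, hσ,
    one_pow, one_pow, one_pow, one_mul, ← pow_mul,
    show h * (2 * (N + 1)) = (p - 1) * (N + 1) by rw [hh, Nat.add_sub_cancel]; ring] at taylor
  rw [show 2 * N + 1 + 1 = 2 * (N + 1) by ring] at key
  refine (dvd_sub key (taylor.mul_left (χ * F))).trans (dvd_of_eq ?_)
  ring

end IsLucasSeq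

/-! ### Central binomial coefficients and Catalan sums -/

/-- Take the coefficient of `X^(pn)`: the linear term of the expansion has only exponents prime to
`p`, so it contributes nothing. -/
theorem pow_dvd_centralBinom_mul_sub {p : ℕ} (hp : p.Prime) (hodd : Odd p) {v N : ℕ}
    (hN : p ^ v ∣ N + 1) :
    (p : ℤ) ^ (v + 2) ∣
      ((2 * (p * (N + 1))).choose (p * (N + 1)) : ℤ) - ((2 * (N + 1)).choose (N + 1) : ℤ) := by
  have hN2 : p ^ v ∣ (2 * N + 1) + 1 := by
    rw [show 2 * N + 1 + 1 = 2 * (N + 1) by ring]; exact hN.mul_left 2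
  have key := pow_dvd_sum_choose_mul_sub hp hodd hN2 (fun k => if k = p * (N + 1) then 1 else 0)
  have e1 : ∀ s, (if p * s = p * (N + 1) then (1 : ℤ) else 0) = if s = N + 1 then 1 else 0 := by
    intro s
    simp only [Nat.mul_right_inj hp.ne_zero]
  have e2 : ∑ s ∈ Finset.range (2 * N + 1 + 1), ((2 * N + 1).choose s : ℤ) *
      ∑ i ∈ Finset.Ico 1 p, (p.choose i : ℤ) * (if p * s + i = p * (N + 1) then 1 else 0) = 0 := by
    refine Finset.sum_eq_zero fun s _ => ?_
    rw [Finset.sum_eq_zero, mul_zero]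
    intro i hi
    rw [Finset.mem_Ico] at hi
    rw [if_neg, mul_zero]
    intro h
    have : p ∣ i := (Nat.dvd_add_right (Dvd.intro s rfl)).1 (h ▸ Dvd.intro (N + 1) rfl)
    exact absurd (Nat.le_of_dvd (by omega) this) (by omega)
  rw [e2] at key
  simp only [e1, mul_ite, mul_one, mul_zero, sub_zero] at key
  rw [Finset.sum_ite_eq' , Finset.sum_ite_eq', if_pos, if_pos] at key
  · rwa [show 2 * N + 1 + 1 = 2 * (N + 1) by ring, mul_left_comm] at key
  · simp; omega
  · have : p * (N + 1) ≤ p * (2 * N + 1 + 1) := Nat.mul_le_mul_left p (by omega)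
    simp; omega

/-- Telescoping of `2 C_k = 4 C(2k,k) - C(2k+2,k+1)`. -/
theorem two_mul_sum_catalan (N : ℕ) :
    2 * ∑ k ∈ Finset.range N, (catalan k : ℤ)
      = 3 * ∑ k ∈ Finset.range N, ((2 * k).choose k : ℤ) + 1 - ((2 * N).choose N : ℤ) := by
  induction N with
  | zero => simp
  | succ N ih =>
    rw [Finset.sum_range_succ, Finset.sum_range_succ, mul_add, ih]
    have h1 := succ_mul_catalan_eq_centralBinom N
    have h2 := Nat.succ_mul_centralBinom_succ N
    rw [Nat.centralBinom] at h1
    rw [Nat.centralBinom, Nat.centralBinom] at h2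
    zify at h1 h2
    have h3 : ((N : ℤ) + 1) ≠ 0 := by positivity
    have h4 : 2 * (catalan N : ℤ) + ((2 * (N + 1)).choose (N + 1) : ℤ)
        = 4 * ((2 * N).choose N : ℤ) := by
      apply mul_left_cancel₀ h3
      linear_combination 2 * h1 + h2
    linarith

/-! ### From integer divisibility to `p`-adic congruences -/

/-- Here `t` clears denominators and is a `p`-adic unit. Taking `v` to be the exact exponent of `p`
in `n`, division by `n` costs `p^v` and a unit. -/
theorem padicModEq_one_div_mul_zero {p : ℕ} [hp : Fact p.Prime] {n : ℕ} (hn : n ≠ 0) {t : ℤ}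
    (ht : ¬ (p : ℤ) ∣ t) {d : ℤ} (x : ℚ) (hx : (t : ℚ) * x = d)
    (hd : ∀ v : ℕ, p ^ v ∣ n → (p : ℤ) ^ (v + 2) ∣ d) :
    PadicModEq p (p ^ 2) ((1 / (n : ℚ)) * x) 0 := by
  obtain ⟨v, n', hn', rfl⟩ := Nat.exists_eq_pow_mul_and_not_dvd hn p hp.out.ne_one
  obtain ⟨e, rfl⟩ := hd v (Dvd.intro _ rfl)
  have hs : ¬ (p : ℤ) ∣ t * n' := fun h => (Int.Prime.dvd_mul' hp.out h).elim ht
    (fun h => hn' (Int.natCast_dvd_natCast.1 h))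
  have hnorm : ‖((t * n' : ℤ) : ℚ_[p])‖ = 1 :=
    le_antisymm (Padic.norm_int_le_one _)
      (not_lt.1 fun h => hs (Padic.norm_intCast_lt_one_iff.1 h))
  have ht0 : (t : ℚ) ≠ 0 := by
    rintro h
    exact ht (by rw [Int.cast_eq_zero.1 h]; exact dvd_zero _)
  have hn0 : (n' : ℚ) ≠ 0 := by
    intro h
    exact hn' (by rw [Nat.cast_eq_zero.1 h]; exact dvd_zero _)
  have hp0 : (p : ℚ) ≠ 0 := Nat.cast_ne_zero.2 hp.out.ne_zero
  have hq : (1 / ((p ^ v * n' : ℕ) : ℚ)) * x - 0 = (p ^ 2 : ℕ) * (e / (t * n' : ℤ)) := by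
    have : x = (((p : ℤ) ^ (v + 2) * e : ℤ) : ℚ) / t := by rw [← hx]; field_simp
    rw [this]
    push_cast
    field_simp
    ring
  refine ⟨⟨(e : ℚ_[p]) / ((t * n' : ℤ) : ℚ_[p]), ?_⟩, ?_⟩
  · rw [norm_div, hnorm, div_one]
    exact Padic.norm_int_le_one _
  · rw [hq]
    push_cast
    rfl

namespace IsLucasSeq

variable {m : ℤ} {u : ℤ → ℤ}

/-- This plays the role of Euler's criterion. At `M = 1` the inner binomial sum equals `χ (σ m^h -
1)`, and each `C(p,i)` in it is divisible by `p`. -/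
theorem dvd_mul_pow_sub_one (hu : IsLucasSeq m u) {p h : ℕ} (hp : p.Prime)
    (hh : p = 2 * h + 1) {χ σ : ℤ} (hχ : χ ^ 2 = 1) (h1 : ∀ M : ℤ, u (p * M) = χ * u M)
    (h2 : ∀ M : ℤ, u (p * M - h) + u (p * M - h - 1) = σ * χ * (u M + u (M - 1))) :
    (p : ℤ) ∣ σ * m ^ h - 1 := by
  have h3 := hu.sum_choose_prime hh (p * 1)
  rw [h2, h1, mul_one, sub_self, sub_self, hu.zero, hu.one] at h3
  have h4 : (p : ℤ) ∣ ∑ i ∈ Finset.Ico 1 p, (p.choose i : ℤ) * u (p - i) := by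
    refine Finset.dvd_sum fun i hi => Dvd.dvd.mul_right ?_ _
    rw [Finset.mem_Ico] at hi
    exact Int.natCast_dvd_natCast.2 (hp.dvd_choose_self (by omega) hi.2)
  rw [h3] at h4
  refine (h4.mul_left χ).trans (dvd_of_eq ?_)
  linear_combination (σ * m ^ h - 1) * hχ

theorem padicModEq_sum_centralBinom (hu : IsLucasSeq m u) {p h : ℕ} [hp : Fact p.Prime]
    (hh : p = 2 * h + 1) {χ σ : ℤ} (hσ : σ ^ 2 = 1) (hdvd : (p : ℤ) ∣ σ * m ^ h - 1)
    (h1 : ∀ M : ℤ, u (p * M) = χ * u M)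
    (h2 : ∀ M : ℤ, u (p * M - h) + u (p * M - h - 1) = σ * χ * (u M + u (M - 1)))
    (hm : ¬ (p : ℤ) ∣ m) (N : ℕ) :
    PadicModEq p (p ^ 2)
      ((1 / ((N + 1 : ℕ) : ℚ)) *
        ((∑ k ∈ Finset.range (p * (N + 1)), ((2 * k).choose k : ℚ) / (m : ℚ) ^ k)
          - (χ : ℚ) * ∑ r ∈ Finset.range (N + 1), ((2 * r).choose r : ℚ) / (m : ℚ) ^ r)) 0 := by
  have hm0 : (m : ℚ) ≠ 0 := by
    intro h
    exact hm (by rw [Int.cast_eq_zero.1 h]; exact dvd_zero _)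
  have scale : ∀ A : ℕ, (m : ℚ) ^ (A - 1) *
      ∑ k ∈ Finset.range A, ((2 * k).choose k : ℚ) / (m : ℚ) ^ k
      = ((∑ k ∈ Finset.range A, ((2 * k).choose k : ℤ) * m ^ (A - 1 - k) : ℤ) : ℚ) := by
    intro A
    push_cast
    rw [Finset.mul_sum]
    refine Finset.sum_congr rfl fun k hk => ?_
    rw [Finset.mem_range] at hk
    rw [(pow_sub_mul_pow (m : ℚ) (show k ≤ A - 1 by omega)).symm]
    field_simp
  refine padicModEq_one_div_mul_zero (Nat.succ_ne_zero N) (t := m ^ (p * (N + 1) - 1))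
    (fun hd => hm (Int.Prime.dvd_pow' hp.out hd)) _ ?_
    (fun v hv => hu.pow_dvd_sum_centralBinom_sub hp.out hh hσ hdvd h1 h2 hv)
  have e : p * (N + 1) - 1 = (p - 1) * (N + 1) + (N + 1 - 1) := by
    rw [hh]; simp; ring_nf; omega
  have s1 := scale (p * (N + 1))
  have s2 := scale (N + 1)
  rw [Nat.add_sub_cancel] at s2
  rw [Int.cast_sub, Int.cast_mul, ← s1, ← s2, Int.cast_pow, mul_sub]
  nth_rewrite 2 [e]
  rw [Nat.add_sub_cancel, pow_add]
  push_cast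
  ring

end IsLucasSeq

/-! ### The periodic sequences for `m = 1, 2, 3` -/

theorem isLucasSeq_quadraticChar_three :
    IsLucasSeq 1 fun k => quadraticChar (ZMod 3) (k : ZMod 3) where
  zero := by simp
  one := by simp
  recurrence k := by
    push_cast
    generalize (k : ZMod 3) = a
    revert a
    decide

theorem isLucasSeq_chi_four : IsLucasSeq 2 fun k => ZMod.χ₄ (k : ZMod 4) where
  zero := by simp
  one := by simp
  recurrence k := by
    push_cast
    generalize (k : ZMod 4) = a
    revert a
    decide

/-- The Lucas sequence `u_k(1, 1)`, of period `6`. -/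
def lucasSeqSix (a : ZMod 6) : ℤ :=
  if a = 1 ∨ a = 2 then 1 else if a = 4 ∨ a = 5 then -1 else 0

theorem isLucasSeq_lucasSeqSix : IsLucasSeq 3 fun k => lucasSeqSix (k : ZMod 6) where
  zero := by decide
  one := by decide
  recurrence k := by
    push_cast
    generalize (k : ZMod 6) = a
    revert a
    decide

theorem quadraticChar_three_shift (h M : ℤ) :
    quadraticChar (ZMod 3) (((2 * h + 1) * M - h : ℤ) : ZMod 3)
        + quadraticChar (ZMod 3) (((2 * h + 1) * M - h - 1 : ℤ) : ZMod 3)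
      = 1 * quadraticChar (ZMod 3) ((2 * h + 1 : ℤ) : ZMod 3) *
        (quadraticChar (ZMod 3) (M : ZMod 3) + quadraticChar (ZMod 3) ((M - 1 : ℤ) : ZMod 3)) := by
  push_cast
  generalize (h : ZMod 3) = a
  generalize (M : ZMod 3) = b
  revert a b
  decide

/-- The value of `σ` is forced by `M = 1`: there `σ χ = u (h+1) + u h`, and `χ^2 = 1`. -/
theorem chi_four_shift (h M : ℤ) :
    ZMod.χ₄ (((2 * h + 1) * M - h : ℤ) : ZMod 4) + ZMod.χ₄ (((2 * h + 1) * M - h - 1 : ℤ) : ZMod 4)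
      = (ZMod.χ₄ ((2 * h + 1 : ℤ) : ZMod 4) * (ZMod.χ₄ ((h + 1 : ℤ) : ZMod 4) + ZMod.χ₄ (h : ZMod 4)))
        * ZMod.χ₄ ((2 * h + 1 : ℤ) : ZMod 4) *
        (ZMod.χ₄ (M : ZMod 4) + ZMod.χ₄ ((M - 1 : ℤ) : ZMod 4)) := by
  push_cast
  generalize (h : ZMod 4) = a
  generalize (M : ZMod 4) = b
  revert a b
  decide

theorem chi_four_sq (h : ℤ) : ZMod.χ₄ ((2 * h + 1 : ℤ) : ZMod 4) ^ 2 = 1 ∧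
    (ZMod.χ₄ ((2 * h + 1 : ℤ) : ZMod 4) *
      (ZMod.χ₄ ((h + 1 : ℤ) : ZMod 4) + ZMod.χ₄ (h : ZMod 4))) ^ 2 = 1 := by
  push_cast
  generalize (h : ZMod 4) = a
  revert a
  decide

/-- The sequence is not a character, but it is multiplicative against the residues `1` and `5`, the
odd ones left once `3` is excluded. -/
theorem lucasSeqSix_mul_and_shift (h M : ℤ) (h3 : ((2 * h + 1 : ℤ) : ZMod 6) ≠ 3) :
    lucasSeqSix (((2 * h + 1) * M : ℤ) : ZMod 6)
      = lucasSeqSix ((2 * h + 1 : ℤ) : ZMod 6) * lucasSeqSix (M : ZMod 6) ∧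
    lucasSeqSix (((2 * h + 1) * M - h : ℤ) : ZMod 6)
        + lucasSeqSix (((2 * h + 1) * M - h - 1 : ℤ) : ZMod 6)
      = (lucasSeqSix ((2 * h + 1 : ℤ) : ZMod 6) *
          (lucasSeqSix ((h + 1 : ℤ) : ZMod 6) + lucasSeqSix (h : ZMod 6)))
        * lucasSeqSix ((2 * h + 1 : ℤ) : ZMod 6) *
        (lucasSeqSix (M : ZMod 6) + lucasSeqSix ((M - 1 : ℤ) : ZMod 6)) := by
  push_cast at h3 ⊢
  generalize (h : ZMod 6) = a at *
  generalize (M : ZMod 6) = b at *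
  revert a b
  decide

theorem lucasSeqSix_sq (h : ℤ) (h3 : ((2 * h + 1 : ℤ) : ZMod 6) ≠ 3) :
    lucasSeqSix ((2 * h + 1 : ℤ) : ZMod 6) ^ 2 = 1 ∧
    (lucasSeqSix ((2 * h + 1 : ℤ) : ZMod 6) *
      (lucasSeqSix ((h + 1 : ℤ) : ZMod 6) + lucasSeqSix (h : ZMod 6))) ^ 2 = 1 := by
  push_cast at h3 ⊢
  generalize (h : ZMod 6) = a at *
  revert a
  decide

theorem lucasSeqSix_eq_quadraticChar_three (h : ℤ) (h3 : ((2 * h + 1 : ℤ) : ZMod 6) ≠ 3) :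
    lucasSeqSix ((2 * h + 1 : ℤ) : ZMod 6) = quadraticChar (ZMod 3) ((2 * h + 1 : ℤ) : ZMod 3) := by
  have e : ((2 * h + 1 : ℤ) : ZMod 3) = ZMod.castHom (by norm_num) (ZMod 3)
      ((2 * h + 1 : ℤ) : ZMod 6) := by
    rw [map_intCast]
  rw [e]
  push_cast at h3 ⊢
  generalize (h : ZMod 6) = a at *
  revert a
  decide

/-! ### The four congruences -/

theorem corollary1p1 (p : ℕ) [Fact p.Prime] (hp : Odd p) (n : ℕ) (hn : 1 ≤ n) :
    PadicModEq p (p ^ 2)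
      ((1 / (n : ℚ)) *
        ((∑ k ∈ Finset.range (p * n), ((2 * k).choose k : ℚ))
          - (legendreSym 3 (p : ℤ) : ℚ) *
              ∑ r ∈ Finset.range n, ((2 * r).choose r : ℚ))) 0 ∧
    PadicModEq p (p ^ 2)
      ((1 / (n : ℚ)) *
        ((∑ k ∈ Finset.range (p * n), ((2 * k).choose k : ℚ) / 2 ^ k)
          - (legendreSym p (-1) : ℚ) *
              ∑ r ∈ Finset.range n, ((2 * r).choose r : ℚ) / 2 ^ r)) 0 ∧
    PadicModEq p (p ^ 2)
      ((1 / (n : ℚ)) *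
        ((∑ k ∈ Finset.range (p * n), (catalan k : ℚ))
          - (legendreSym 3 (p : ℤ) : ℚ) * (∑ r ∈ Finset.range n, (catalan r : ℚ))
          + (1 - (legendreSym 3 (p : ℤ) : ℚ)) / 2 * (((2 * n).choose n : ℚ) - 1))) 0 ∧
    (3 < p →
      PadicModEq p (p ^ 2)
        ((1 / (n : ℚ)) *
          ((∑ k ∈ Finset.range (p * n), ((2 * k).choose k : ℚ) / 3 ^ k)
            - (legendreSym 3 (p : ℤ) : ℚ) *
                ∑ r ∈ Finset.range n, ((2 * r).choose r : ℚ) / 3 ^ r)) 0) := by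
  have hp' : p.Prime := Fact.out
  obtain ⟨h, hh⟩ := hp
  obtain ⟨N, rfl⟩ : ∃ N, n = N + 1 := ⟨n - 1, by omega⟩
  have hpc : (p : ℤ) = 2 * h + 1 := by rw [hh]; push_cast; ring
  have not_dvd : ∀ a : ℕ, 0 < a → a < p → ¬ (p : ℤ) ∣ (a : ℤ) := fun a ha hap hd =>
    absurd (Nat.le_of_dvd ha (Int.natCast_dvd_natCast.1 hd)) (by omega)
  have hp2 := hp'.two_le
  have hu1 := isLucasSeq_quadraticChar_three
  have a1 : ∀ M : ℤ, quadraticChar (ZMod 3) ((p * M : ℤ) : ZMod 3)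
      = legendreSym 3 p * quadraticChar (ZMod 3) (M : ZMod 3) := by
    intro M
    rw [Int.cast_mul, map_mul]
    rfl
  have a2 : ∀ M : ℤ, quadraticChar (ZMod 3) ((p * M - h : ℤ) : ZMod 3)
        + quadraticChar (ZMod 3) ((p * M - h - 1 : ℤ) : ZMod 3)
      = 1 * legendreSym 3 p * (quadraticChar (ZMod 3) (M : ZMod 3)
        + quadraticChar (ZMod 3) ((M - 1 : ℤ) : ZMod 3)) := by
    intro M
    rw [legendreSym, hpc]
    exact quadraticChar_three_shift h M
  refine ⟨?_, ?_, ?_, ?_⟩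
  · have := hu1.padicModEq_sum_centralBinom hh (one_pow 2) (by simp) a1 a2
      (by exact_mod_cast not_dvd 1 one_pos (by omega)) N
    simpa using this
  · have hu := isLucasSeq_chi_four
    have hχ : legendreSym p (-1) = ZMod.χ₄ ((2 * h + 1 : ℤ) : ZMod 4) := by
      rw [legendreSym.at_neg_one (by omega), ← hpc, Int.cast_natCast]
    have b1 : ∀ M : ℤ, ZMod.χ₄ ((p * M : ℤ) : ZMod 4)
        = legendreSym p (-1) * ZMod.χ₄ (M : ZMod 4) := by
      intro M
      rw [hχ, hpc, Int.cast_mul, map_mul]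
    have b2 := chi_four_shift h
    obtain ⟨b3, b4⟩ := chi_four_sq h
    rw [← hpc] at b2 b3 b4 hχ
    rw [← hχ] at b2 b3 b4
    have := hu.padicModEq_sum_centralBinom hh b4 (hu.dvd_mul_pow_sub_one hp' hh b3 b1 b2) b1 b2
      (by exact_mod_cast not_dvd 2 two_pos (by omega)) N
    simpa using this
  -- After doubling, the correction term turns the boundary terms of the two Catalan sums into
  -- `C(2n,n) - C(2pn,pn)`.
  · refine padicModEq_one_div_mul_zero (Nat.succ_ne_zero N) (t := 2)
      (by exact_mod_cast not_dvd 2 two_pos (by omega)) _ ?_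
      (fun v hv => dvd_sub
        ((hu1.pow_dvd_sum_centralBinom_sub hp' hh (one_pow 2) (by simp) a1 a2 hv).mul_left 3)
        (pow_dvd_centralBinom_mul_sub hp' ⟨h, hh⟩ hv))
    have c1 := congrArg (Int.cast : ℤ → ℚ) (two_mul_sum_catalan (p * (N + 1)))
    have c2 := congrArg (Int.cast : ℤ → ℚ) (two_mul_sum_catalan (N + 1))
    push_cast at c1 c2 ⊢
    simp only [one_pow, mul_one]
    linear_combination c1 - (legendreSym 3 p : ℚ) * c2
  · intro hp3
    have hu := isLucasSeq_lucasSeqSix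
    have h3 : ((2 * h + 1 : ℤ) : ZMod 6) ≠ 3 := by
      intro h6
      have h7 : (((2 * h + 1 : ℤ) - 3 : ℤ) : ZMod 6) = 0 := by
        rw [Int.cast_sub, h6]; rfl
      rw [ZMod.intCast_zmod_eq_zero_iff_dvd, ← hpc] at h7
      have h8 : 3 ∣ p := by omega
      have := (Nat.prime_dvd_prime_iff_eq Nat.prime_three hp').1 h8
      omega
    have hχ : legendreSym 3 p = lucasSeqSix ((2 * h + 1 : ℤ) : ZMod 6) := by
      rw [lucasSeqSix_eq_quadraticChar_three _ h3, legendreSym, hpc]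
    have b1 := fun M => (lucasSeqSix_mul_and_shift h M h3).1
    have b2 := fun M => (lucasSeqSix_mul_and_shift h M h3).2
    obtain ⟨b3, b4⟩ := lucasSeqSix_sq h h3
    rw [← hpc] at b1 b2 b3 b4 hχ
    rw [← hχ] at b1 b2 b3 b4
    have := hu.padicModEq_sum_centralBinom hh b4 (hu.dvd_mul_pow_sub_one hp' hh b3 b1 b2) b1 b2
      (by exact_mod_cast not_dvd 3 three_pos hp3) N
    simpa using this
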